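/- All graphs are finite, simple and connected, with at least one vertex. A block graph is a connected graph in which every block (maximal connected subgraph without a cut vertex of its own) is a clique. A graph is strictly chordal if it is obtained from a block graph by adding zero or more true twins to each of its vertices (true twins are vertices $u,v$ with equal closed neighborhoods $N[u]=N[v]$). A graph is interval if it is the intersection graph of a family of nonempty intervals of the real line, and strictly interval if it is both strictly chordal and interval. A critical clique of $G$ is a set of vertices that is maximal among the cliques whose vertices are pairwise true twins. The critical clique graph $CC(G)$ has the critical cliques of $G$ as vertices, two distinct ones being adjacent if and only if some vertex of one is adjacent in $G$ to some vertex of the other. The derived graph $D(H)$ of a graph $H$ is the induced subgraph obtained by deleting all simplicial vertices of $H$, that is, all vertices whose neighborhood is a clique. Theorem. Let $G$ be a non-complete strictly chordal graph. Then $G$ is strictly interval if and only if $D(CC(G))$ is a path (a path has at least one vertex; a single vertex is a path). -/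

import Mathlib

namespace StrictlyInterval

universe u

variable {V : Type u}

/-- A set of vertices `S` such that the induced subgraph on `S` is connected (hence nonempty) and
has no cut vertex: deleting any vertex of `S` does not disconnect it. -/
def IsNonseparable (G : SimpleGraph V) (S : Set V) : Prop :=
  (G.induce S).Connected ∧ ∀ x ∈ S, (G.induce (S \ {x})).Preconnected

/-- A block of `G`: a maximal connected subgraph without a cut vertex of its own.  Such a subgraph
is necessarily induced, so it is represented by its vertex set. -/
def IsBlock (G : SimpleGraph V) (S : Set V) : Prop :=
  Maximal (IsNonseparable G) S

/-- A block graph: a connected graph each of whose blocks is a clique. -/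
def IsBlockGraph (G : SimpleGraph V) : Prop :=
  G.Connected ∧ ∀ S : Set V, IsBlock G S → G.IsClique S

/-- `G` is strictly chordal: it is obtained from a block graph `B` by adding zero or more true
twins to each vertex of `B`.  The map `f` sends every vertex of `G` to the vertex of `B` of which
it is a copy; the fibres of `f` are nonempty, copies of one vertex are adjacent to each other, and
copies of distinct vertices are adjacent exactly when these vertices are. -/
def IsStrictlyChordal (G : SimpleGraph V) : Prop :=
  ∃ (W : Type u) (B : SimpleGraph W) (f : V → W),
    IsBlockGraph B ∧ Function.Surjective f ∧
      ∀ x y : V, G.Adj x y ↔ x ≠ y ∧ (f x = f y ∨ B.Adj (f x) (f y))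

/-- `G` is an interval graph: the intersection graph of a family of (nonempty, closed and bounded)
intervals of the real line. -/
def IsIntervalGraph (G : SimpleGraph V) : Prop :=
  ∃ a b : V → ℝ, (∀ x, a x ≤ b x) ∧
    ∀ x y : V, x ≠ y →
      (G.Adj x y ↔ (Set.Icc (a x) (b x) ∩ Set.Icc (a y) (b y)).Nonempty)

/-- A strictly interval graph: at the same time strictly chordal and interval. -/
def IsStrictlyIntervalGraph (G : SimpleGraph V) : Prop :=
  IsStrictlyChordal G ∧ IsIntervalGraph G

/-- The closed neighborhood `N[x]`. -/
def closedNeighborhood (G : SimpleGraph V) (x : V) : Set V :=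
  insert x (G.neighborSet x)

/-- True twins: vertices with the same closed neighborhood. -/
def TrueTwins (G : SimpleGraph V) (x y : V) : Prop :=
  closedNeighborhood G x = closedNeighborhood G y

/-- A critical clique: a set of vertices that is maximal among the cliques whose vertices are
pairwise true twins. -/
def IsCriticalClique (G : SimpleGraph V) (Q : Set V) : Prop :=
  Maximal (fun S : Set V => G.IsClique S ∧ ∀ x ∈ S, ∀ y ∈ S, TrueTwins G x y) Q

/-- The critical clique graph `CC(G)`: its vertices are the critical cliques of `G`, and two
distinct ones are adjacent when some vertex of one is a neighbor in `G` of a vertex of the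
other. -/
def criticalCliqueGraph (G : SimpleGraph V) :
    SimpleGraph {Q : Set V // IsCriticalClique G Q} where
  Adj Q R := Q ≠ R ∧ ∃ x ∈ Q.1, ∃ y ∈ R.1, G.Adj x y
  symm := ⟨fun _ _ ⟨hne, x, hx, y, hy, hxy⟩ => ⟨hne.symm, y, hy, x, hx, hxy.symm⟩⟩
  loopless := ⟨fun _ h => h.1 rfl⟩

/-- A simplicial vertex: its neighborhood is a clique. -/
def IsSimplicial (G : SimpleGraph V) (x : V) : Prop :=
  G.IsClique (G.neighborSet x)

/-- The derived graph `D(G)`: the induced subgraph obtained by deleting all simplicial vertices. -/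
def derivedGraph (G : SimpleGraph V) : SimpleGraph {x : V | ¬ IsSimplicial G x} :=
  G.induce {x : V | ¬ IsSimplicial G x}

/-- `G` is a path: it is isomorphic to the path on `n + 1` vertices for some `n`.  A single vertex
is a path, the graph without vertices is not. -/
def IsPathGraph (G : SimpleGraph V) : Prop :=
  ∃ n : ℕ, Nonempty (G ≃g SimpleGraph.pathGraph (n + 1))

end StrictlyInterval

namespace StrictlyInterval

universe w

variable {V : Type u} {U : Type w}

/-! `G` is a twin blow-up of `CC(G)`, so one is interval iff the other is. `CC(G)` is connected, has
no true twins (so its simplicial vertices are pairwise nonadjacent), and is an induced subgraph of a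
block graph, hence `DiamondFree`.

In an interval model of such a graph, a nonsimplicial vertex has two neighbors with disjoint
intervals, and no third neighbor is adjacent to both. So nonsimplicial intervals are never nested,
and ordered by left endpoint they are adjacent exactly when consecutive
(`isPathGraph_derivedGraph`). Conversely, lay the path out as overlapping intervals and insert each
simplicial vertex as a point covered by just its neighbors
(`isIntervalGraph_of_isPathGraph_derivedGraph`). -/

/-- Two distinct vertices with two adjacent common neighbors are adjacent. -/
def DiamondFree (G : SimpleGraph V) : Prop :=
  ∀ u v x y : V, G.Adj u v → G.Adj u x → G.Adj u y → G.Adj v x → G.Adj v y → x ≠ y → G.Adj x y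

/-- `G` arises from `H` by replacing the vertices of `H` by the fibres of `p`, made cliques of
true twins. -/
def IsTwinBlowup (G : SimpleGraph V) (H : SimpleGraph U) (p : V → U) : Prop :=
  Function.Surjective p ∧ ∀ x y : V, G.Adj x y ↔ x ≠ y ∧ (p x = p y ∨ H.Adj (p x) (p y))

/-! ### Block graphs contain no induced diamond -/

theorem preconnected_induce_of_common_neighbor (G : SimpleGraph V) (S : Set V)
    (h : ∀ x ∈ S, ∀ y ∈ S, x ≠ y → G.Adj x y ∨ ∃ z ∈ S, G.Adj x z ∧ G.Adj z y) :
    (G.induce S).Preconnected := by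
  rintro ⟨x, hx⟩ ⟨y, hy⟩
  by_cases hxy : x = y
  · subst hxy
    exact SimpleGraph.Reachable.refl _
  · rcases h x hx y hy hxy with h1 | ⟨z, hz, h1, h2⟩
    · exact SimpleGraph.Adj.reachable (G := G.induce S) (u := ⟨x, hx⟩) (v := ⟨y, hy⟩) h1
    · exact (SimpleGraph.Adj.reachable (G := G.induce S) (u := ⟨x, hx⟩) (v := ⟨z, hz⟩) h1).trans
        (SimpleGraph.Adj.reachable (G := G.induce S) (u := ⟨z, hz⟩) (v := ⟨y, hy⟩) h2)

theorem IsBlockGraph.diamondFree [Finite V] {G : SimpleGraph V} (hG : IsBlockGraph G) :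
    DiamondFree G := by
  intro u v x y huv hux huy hvx hvy hxy
  have hS : IsNonseparable G {u, v, x, y} := by
    have huv' := huv.symm
    have hux' := hux.symm
    have huy' := huy.symm
    have hvx' := hvx.symm
    have hvy' := hvy.symm
    refine ⟨@SimpleGraph.Connected.mk _ _
      (preconnected_induce_of_common_neighbor G _ ?_) ⟨⟨u, by simp⟩⟩, ?_⟩
    · rintro a (rfl | rfl | rfl | rfl) b (rfl | rfl | rfl | rfl) hab <;>
        first
        | exact absurd rfl hab
        | exact Or.inl (by assumption)
        | exact Or.inr ⟨u, by simp, by assumption, by assumption⟩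
    · intro z _
      refine preconnected_induce_of_common_neighbor G _ ?_
      -- One of the two dominating vertices `u`, `v` survives the deletion of `z` and links the
      -- rest.
      have hz : z ≠ u ∨ z ≠ v := by
        by_contra! h
        exact huv.ne (h.1.symm.trans h.2)
      rintro a ⟨rfl | rfl | rfl | rfl, ha⟩ b ⟨rfl | rfl | rfl | rfl, hb⟩ hab <;>
        first
        | exact absurd rfl hab
        | exact Or.inl (by assumption)
        | exact hz.elim
            (fun h => Or.inr ⟨u, ⟨by simp, h.symm⟩, by assumption, by assumption⟩)
            (fun h => Or.inr ⟨v, ⟨by simp, h.symm⟩, by assumption, by assumption⟩)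
  obtain ⟨M, hSM, hM⟩ := (Set.toFinite {S | IsNonseparable G S}).exists_le_maximal hS
  exact hG.2 M hM (hSM (by simp)) (hSM (by simp)) hxy

/-! ### Twin blow-ups -/

namespace IsTwinBlowup

variable {G : SimpleGraph V} {H : SimpleGraph U} {p : V → U}

theorem closedNeighborhood_eq (h : IsTwinBlowup G H p) (x : V) :
    closedNeighborhood G x = p ⁻¹' closedNeighborhood H (p x) := by
  ext y
  have := h.2 x y
  simp only [closedNeighborhood, Set.mem_insert_iff, SimpleGraph.mem_neighborSet, this,
    Set.mem_preimage]
  by_cases hxy : y = x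
  · simp [hxy]
  · simp [hxy, Ne.symm hxy, eq_comm]

theorem trueTwins_iff (h : IsTwinBlowup G H p) (x y : V) :
    TrueTwins G x y ↔ TrueTwins H (p x) (p y) := by
  rw [TrueTwins, h.closedNeighborhood_eq, h.closedNeighborhood_eq, TrueTwins]
  exact h.1.preimage_injective.eq_iff

theorem isIntervalGraph_iff (h : IsTwinBlowup G H p) :
    IsIntervalGraph G ↔ IsIntervalGraph H := by
  constructor
  · rintro ⟨a, b, hab, hadj⟩
    obtain ⟨s, hs⟩ := h.1.hasRightInverse
    refine ⟨a ∘ s, b ∘ s, fun x => hab _, fun x y hxy => ?_⟩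
    have hne : s x ≠ s y := fun e => hxy (hs.injective e)
    simp only [Function.comp_apply]
    rw [← hadj _ _ hne, h.2, hs x, hs y]
    simp [hne, hxy]
  · rintro ⟨a, b, hab, hadj⟩
    refine ⟨a ∘ p, b ∘ p, fun x => hab _, fun x y hxy => ?_⟩
    rw [h.2]
    by_cases hp : p x = p y
    · simp [hxy, hp, hab]
    · simp [hxy, hp, hadj _ _ hp]

end IsTwinBlowup

theorem trueTwins_of_adj_of_isSimplicial {G : SimpleGraph V} {x y : V} (hxy : G.Adj x y)
    (hx : IsSimplicial G x) (hy : IsSimplicial G y) : TrueTwins G x y := by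
  have key : ∀ {x y : V}, G.Adj x y → IsSimplicial G x →
      closedNeighborhood G x ⊆ closedNeighborhood G y := by
    rintro x y hxy hx z (rfl | hz)
    · exact Or.inr hxy.symm
    · by_cases hzy : z = y
      · exact Or.inl hzy
      · exact Or.inr (hx hxy hz (Ne.symm hzy))
  exact (key hxy hx).antisymm (key hxy.symm hy)

/-! ### Critical cliques as twin classes -/

theorem isCriticalClique_setOf_trueTwins (G : SimpleGraph V) (x : V) :
    IsCriticalClique G {y | TrueTwins G x y} := by
  refine ⟨⟨fun y hy z hz hyz => ?_, fun y hy z hz => hy.symm.trans hz⟩, ?_⟩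
  · have h : z ∈ closedNeighborhood G y := by
      rw [show closedNeighborhood G y = closedNeighborhood G z from hy.symm.trans hz]
      exact Or.inl rfl
    exact h.resolve_left hyz.symm
  · intro S hS hle y hy
    exact hS.2 x (hle rfl) y hy

/-- The critical clique containing a given vertex. -/
def toCriticalClique (G : SimpleGraph V) (x : V) : {Q : Set V // IsCriticalClique G Q} :=
  ⟨{y | TrueTwins G x y}, isCriticalClique_setOf_trueTwins G x⟩

theorem toCriticalClique_eq_iff {G : SimpleGraph V} {x y : V} :
    toCriticalClique G x = toCriticalClique G y ↔ TrueTwins G x y := by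
  refine ⟨fun h => ?_, fun h => Subtype.ext (Set.ext fun z => ?_)⟩
  · have hy : y ∈ (toCriticalClique G y).1 := rfl
    rwa [← h] at hy
  · exact ⟨fun hz => h.symm.trans hz, fun hz => h.trans hz⟩

theorem isTwinBlowup_toCriticalClique [Nonempty V] (G : SimpleGraph V) :
    IsTwinBlowup G (criticalCliqueGraph G) (toCriticalClique G) := by
  refine ⟨fun Q => ?_, fun x y => ?_⟩
  · have hne : Q.1.Nonempty := by
      by_contra hQ
      rw [Set.not_nonempty_iff_eq_empty] at hQ
      obtain ⟨x⟩ := ‹Nonempty V›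
      have := Q.2.2 (isCriticalClique_setOf_trueTwins G x).1 (by simp [hQ])
      rw [hQ] at this
      exact this (show TrueTwins G x x from rfl)
    obtain ⟨x, hx⟩ := hne
    refine ⟨x, Subtype.ext (Set.Subset.antisymm ?_ ?_)⟩
    · exact Q.2.2 (isCriticalClique_setOf_trueTwins G x).1 fun y hy => Q.2.1.2 x hx y hy
    · exact fun y hy => Q.2.1.2 x hx y hy
  · constructor
    · intro h
      refine ⟨h.ne, or_iff_not_imp_left.2 fun hne => ⟨hne, x, ?_, y, ?_, h⟩⟩ <;>
        exact (rfl : TrueTwins G _ _)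
    · rintro ⟨hxy, h | ⟨-, x', hx', y', hy', h⟩⟩
      · exact (isCriticalClique_setOf_trueTwins G x).1.1 (show TrueTwins G x x from rfl)
          (toCriticalClique_eq_iff.1 h) hxy
      · have hx : TrueTwins G x x' := hx'
        have hy : TrueTwins G y y' := hy'
        have h1 : y' ∈ closedNeighborhood G x := by
          rw [show closedNeighborhood G x = _ from hx]
          exact Or.inr h
        rcases h1 with h1 | h1
        · have : x ∈ closedNeighborhood G y := by
            rw [show closedNeighborhood G y = _ from hy]
            exact Or.inl h1.symm
          exact (this.resolve_left hxy).symm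
        · have : x ∈ closedNeighborhood G y := by
            rw [show closedNeighborhood G y = _ from hy]
            exact Or.inr h1.symm
          exact (this.resolve_left hxy).symm

/-! ### The critical clique graph of a strictly chordal graph -/

theorem IsStrictlyChordal.nonempty {G : SimpleGraph V} (hG : IsStrictlyChordal G) :
    Nonempty V := by
  obtain ⟨W, B, f, hB, hf, -⟩ := hG
  obtain ⟨w⟩ := hB.1.nonempty
  exact ⟨(hf w).choose⟩

theorem IsStrictlyChordal.connected_criticalCliqueGraph {G : SimpleGraph V}
    (hG : IsStrictlyChordal G) : (criticalCliqueGraph G).Connected := by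
  have := hG.nonempty
  obtain ⟨W, B, f, hB, hf, hadj⟩ := hG
  have hfB : IsTwinBlowup G B f := ⟨hf, hadj⟩
  have hp := isTwinBlowup_toCriticalClique G
  obtain ⟨s, hs⟩ := hf.hasRightInverse
  have hstep : ∀ w w' : W, B.Adj w w' →
      (criticalCliqueGraph G).Reachable (toCriticalClique G (s w)) (toCriticalClique G (s w')) := by
    intro w w' h
    have hne : s w ≠ s w' := fun e => h.ne (hs.injective e)
    have h1 : G.Adj (s w) (s w') := (hadj _ _).2 ⟨hne, Or.inr (by rwa [hs, hs])⟩
    rcases ((hp.2 _ _).1 h1).2 with h2 | h2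
    · rw [h2]
    · exact h2.reachable
  have hwalk : ∀ w w' : W, B.Walk w w' →
      (criticalCliqueGraph G).Reachable (toCriticalClique G (s w)) (toCriticalClique G (s w')) := by
    intro w w' q
    induction q with
    | nil => exact SimpleGraph.Reachable.refl _
    | cons h _ ih => exact (hstep _ _ h).trans ih
  have hsf : ∀ x, toCriticalClique G (s (f x)) = toCriticalClique G x := fun x => by
    rw [toCriticalClique_eq_iff, hfB.trueTwins_iff, hs]
    rfl
  refine @SimpleGraph.Connected.mk _ _ (fun Q R => ?_) ⟨toCriticalClique G (Classical.arbitrary V)⟩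
  obtain ⟨x, rfl⟩ := hp.1 Q
  obtain ⟨y, rfl⟩ := hp.1 R
  obtain ⟨q⟩ := hB.1.preconnected (f x) (f y)
  rw [← hsf x, ← hsf y]
  exact hwalk _ _ q

/-- `B` may itself have twins, so `CC(G)` need not be `B`; one representative per critical clique
still embeds it as an induced subgraph. -/
theorem IsStrictlyChordal.diamondFree_criticalCliqueGraph [Finite V] {G : SimpleGraph V}
    (hG : IsStrictlyChordal G) : DiamondFree (criticalCliqueGraph G) := by
  have := hG.nonempty
  obtain ⟨W, B, f, hB, hf, hadj⟩ := hG
  have hfB : IsTwinBlowup G B f := ⟨hf, hadj⟩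
  have hp := isTwinBlowup_toCriticalClique G
  have : Finite W := Finite.of_surjective f hf
  obtain ⟨s, hs⟩ := hp.1.hasRightInverse
  have hinj : ∀ Q R, Q ≠ R → f (s Q) ≠ f (s R) := by
    intro Q R hne h
    apply hne
    rw [← hs Q, ← hs R, toCriticalClique_eq_iff, hfB.trueTwins_iff, h]
    rfl
  have hiff : ∀ Q R, (criticalCliqueGraph G).Adj Q R ↔ B.Adj (f (s Q)) (f (s R)) := by
    intro Q R
    by_cases hQR : Q = R
    · simp [hQR]
    · have h1 := hp.2 (s Q) (s R)
      have h2 := hadj (s Q) (s R)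
      rw [hs, hs] at h1
      simp only [hQR, hinj Q R hQR, false_or] at h1 h2
      have hne : s Q ≠ s R := fun e => hQR (hs.injective e)
      tauto
  intro u v x y huv hux huy hvx hvy hxy
  rw [hiff] at *
  exact hB.diamondFree _ _ _ _ huv hux huy hvx hvy (hinj _ _ hxy)

theorem not_trueTwins_criticalCliqueGraph [Nonempty V] (G : SimpleGraph V)
    {Q R : {Q : Set V // IsCriticalClique G Q}} (h : TrueTwins (criticalCliqueGraph G) Q R) :
    Q = R := by
  have hp := isTwinBlowup_toCriticalClique G
  obtain ⟨x, rfl⟩ := hp.1 Q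
  obtain ⟨y, rfl⟩ := hp.1 R
  rw [toCriticalClique_eq_iff, hp.trueTwins_iff]
  exact h

/-! ### From an interval model to a path -/

theorem exists_adj_mem_notMem {G : SimpleGraph V} (hG : G.Preconnected) {S : Set V} {u v : V}
    (hu : u ∈ S) (hv : v ∉ S) : ∃ x ∈ S, ∃ y ∉ S, G.Adj x y := by
  obtain ⟨q⟩ := hG u v
  obtain ⟨d, -, h1, h2⟩ := q.exists_boundary_dart S hu hv
  exact ⟨d.fst, h1, d.snd, h2, d.adj⟩

theorem Icc_inter_Icc_nonempty_iff {a b c d : ℝ} (hab : a ≤ b) (hcd : c ≤ d) :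
    (Set.Icc a b ∩ Set.Icc c d).Nonempty ↔ a ≤ d ∧ c ≤ b := by
  rw [Set.Icc_inter_Icc, Set.nonempty_Icc, sup_le_iff, le_inf_iff, le_inf_iff]
  tauto

/-- The derived graph of a connected diamond-free interval graph is a path as soon as it has a
vertex. -/
theorem isPathGraph_derivedGraph [Finite V] {G : SimpleGraph V} (hconn : G.Preconnected)
    (hdf : DiamondFree G) (hint : IsIntervalGraph G) (hne : ∃ x, ¬ IsSimplicial G x) :
    IsPathGraph (derivedGraph G) := by
  obtain ⟨a, b, hab, hadj'⟩ := hint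
  have hadj : ∀ x y, x ≠ y → (G.Adj x y ↔ a x ≤ b y ∧ a y ≤ b x) := fun x y hxy => by
    rw [hadj' x y hxy, Icc_inter_Icc_nonempty_iff (hab x) (hab y)]
  clear hadj'
  have hsep : ∀ v, ¬ IsSimplicial G v → ∃ x y, G.Adj v x ∧ G.Adj v y ∧ b x < a y := by
    intro v hv
    simp only [IsSimplicial, SimpleGraph.IsClique, Set.Pairwise, not_forall] at hv
    obtain ⟨x, hx, y, hy, hxy, hn⟩ := hv
    rw [hadj x y hxy, not_and_or, not_le, not_le] at hn
    rcases hn with h | h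
    · exact ⟨y, x, hy, hx, h⟩
    · exact ⟨x, y, hx, hy, h⟩
  -- two nonadjacent neighbors of `v` are not both in the closed neighborhood of a neighbor of `v`
  have hcommon : ∀ u v x y, u ≠ v → G.Adj v u → G.Adj v x → G.Adj v y → b x < a y →
      (x = u ∨ G.Adj u x) → (y = u ∨ G.Adj u y) → False := by
    intro u v x y huv hvu hvx hvy hlt hx hy
    have hxy : x ≠ y := by
      rintro rfl
      exact absurd (hab x) (not_le.2 hlt)
    have hn : ¬ G.Adj x y := fun h => absurd ((hadj x y hxy).1 h).2 (not_le.2 hlt)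
    rcases hx with rfl | hx
    · rcases hy with rfl | hy
      · exact hxy rfl
      · exact hn hy
    · rcases hy with rfl | hy
      · exact hn hx.symm
      · exact hn (hdf v u x y hvu hvx hvy hx hy hxy)
  have hmeet : ∀ u x, a x ≤ b u → a u ≤ b x → x = u ∨ G.Adj u x := by
    intro u x h1 h2
    by_cases h : x = u
    · exact Or.inl h
    · exact Or.inr ((hadj u x (Ne.symm h)).2 ⟨h2, h1⟩)
  -- If the interval of `v` lay inside that of `u`, every neighbor of `v` would meet `u`.
  have hnest : ∀ u v, u ≠ v → ¬ IsSimplicial G v → a u ≤ a v → b u < b v := by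
    intro u v huv hv h
    by_contra! hb
    obtain ⟨x, y, hx, hy, hlt⟩ := hsep v hv
    have hx' := (hadj _ _ hx.ne).1 hx
    have hy' := (hadj _ _ hy.ne).1 hy
    refine hcommon u v x y huv ((hadj _ _ huv.symm).2 ⟨?_, ?_⟩) hx hy hlt (hmeet _ _ ?_ ?_)
      (hmeet _ _ ?_ ?_) <;> linarith [hab u, hab v]
  have hinj : ∀ u v, ¬ IsSimplicial G u → ¬ IsSimplicial G v → a u = a v → u = v := by
    intro u v hu hv h
    by_contra huv
    exact lt_asymm (hnest u v huv hv h.le) (hnest v u (Ne.symm huv) hu h.ge)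
  have htriangle : ∀ u v w, ¬ IsSimplicial G v → ¬ IsSimplicial G w → a u < a v → a v < a w →
      ¬ G.Adj u w := by
    intro u v w hv hw huv hvw h
    have huv' : u ≠ v := by rintro rfl; exact lt_irrefl _ huv
    have hvw' : v ≠ w := by rintro rfl; exact lt_irrefl _ hvw
    have hb1 := hnest u v huv' hv huv.le
    have hb2 := hnest v w hvw' hw hvw.le
    have h' := (hadj _ _ h.ne).1 h
    obtain ⟨x, y, hx, hy, hlt⟩ := hsep v hv
    have hvu : G.Adj v u := (hadj _ _ huv'.symm).2 ⟨by linarith, by linarith [hab v]⟩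
    have hvw2 : G.Adj v w := (hadj _ _ hvw').2 ⟨by linarith [hab v], by linarith⟩
    -- The intervals of `u` and `w` together cover that of `v`; a neighbor `z` of `v` meeting `w` is
    -- adjacent to `u` by diamond-freeness on the edge `v w`.
    have hall : ∀ z, G.Adj v z → z = u ∨ G.Adj u z := by
      intro z hz
      by_cases hzu : z = u
      · exact Or.inl hzu
      by_cases hzw : z = w
      · exact Or.inr (hzw ▸ h)
      have hz' := (hadj _ _ hz.ne).1 hz
      rcases le_total (a z) (b u) with h1 | h1
      · exact hmeet u z h1 (by linarith)
      · have hwz : G.Adj w z :=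
          (hadj _ _ (Ne.symm hzw)).2 ⟨by linarith [hab z], by linarith⟩
        exact Or.inr (hdf v w u z hvw2 hvu hz h.symm hwz (Ne.symm hzu))
    exact hcommon u v x y huv' hvu hx hy hlt (hall x hx) (hall y hy)
  have hgap : ∀ u v, ¬ IsSimplicial G u → ¬ IsSimplicial G v → a u < a v →
      (∀ w, ¬ IsSimplicial G w → a u < a w → a v ≤ a w) → G.Adj u v := by
    intro u v hu hv huv hcov
    have hne : u ≠ v := by rintro rfl; exact lt_irrefl _ huv
    by_contra hn
    rw [hadj u v hne, not_and_or, not_le, not_le] at hn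
    have hlt : b u < a v := hn.resolve_left (by linarith [hab v])
    -- Some edge `x y` must cross the gap after `b u`. Then `x` has the nonadjacent neighbors `u`
    -- and `y`, so it is nonsimplicial and starts strictly between `u` and `v`.
    obtain ⟨x, hx, y, hy, hxy⟩ := exists_adj_mem_notMem hconn (S := {z | a z ≤ b u})
      (u := u) (v := v) (hab u) (not_le.2 hlt)
    replace hx : a x ≤ b u := hx
    replace hy : b u < a y := not_le.1 hy
    have hxy' := (hadj _ _ hxy.ne).1 hxy
    have hxu : x ≠ u := by rintro rfl; linarith
    have hyu : y ≠ u := by rintro rfl; linarith [hab y]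
    have hxD : ¬ IsSimplicial G x := by
      intro hs
      have h1 : G.Adj x u := (hadj _ _ hxu).2 ⟨hx, by linarith [hab u]⟩
      have h2 := (hadj _ _ hyu).1 (hs hxy h1 hyu)
      linarith
    have hax : a u < a x := by
      by_contra! h
      have := hnest x u hxu hu h
      linarith
    linarith [hcov x hxD hax]
  let D := {x : V | ¬ IsSimplicial G x}
  have hDinj : Function.Injective (fun x : D => a x.1) :=
    fun x y h => Subtype.ext (hinj _ _ x.2 y.2 h)
  let _ : LinearOrder D := LinearOrder.lift' (fun x : D => a x.1) hDinj
  have hlt : ∀ x y : D, x < y ↔ a x.1 < a y.1 := fun _ _ => Iff.rfl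
  have hcov : ∀ x y : D, x < y → ((derivedGraph G).Adj x y ↔ x ⋖ y) := by
    intro x y hxy
    constructor
    · intro h
      exact ⟨hxy, fun z h1 h2 => htriangle _ _ _ z.2 y.2 ((hlt _ _).1 h1) ((hlt _ _).1 h2) h⟩
    · intro h
      refine hgap _ _ x.2 y.2 hxy fun w hw hxw => ?_
      by_contra! hwy
      exact h.2 (c := ⟨w, hw⟩) hxw hwy
  have := Fintype.ofFinite D
  obtain ⟨x₀, hx₀⟩ := hne
  have : Nonempty D := ⟨⟨x₀, hx₀⟩⟩
  obtain ⟨n, hn⟩ := Nat.exists_eq_succ_of_ne_zero (Fintype.card_ne_zero (α := D))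
  let e : D ≃o Fin (n + 1) := (Fintype.orderIsoFinOfCardEq D hn).symm
  refine ⟨n, ⟨⟨e.toEquiv, fun {x y} => ?_⟩⟩⟩
  -- `pathGraph` is a Hasse diagram, so adjacency becomes the covering relation.
  change (SimpleGraph.hasse (Fin (n + 1))).Adj (e x) (e y) ↔ (derivedGraph G).Adj x y
  rw [SimpleGraph.hasse_adj, apply_covBy_apply_iff, apply_covBy_apply_iff]
  rcases lt_trichotomy x y with h | h | h
  · rw [hcov x y h]
    exact or_iff_left fun h' => h'.1.asymm h
  · subst h
    simp
  · rw [SimpleGraph.adj_comm, hcov y x h]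
    exact or_iff_right fun h' => h'.1.asymm h

/-! ### From a path to an interval model -/

/-- A connected graph whose simplicial vertices are pairwise nonadjacent and whose derived graph is
a path is an interval graph. -/
theorem isIntervalGraph_of_isPathGraph_derivedGraph [Finite V] {G : SimpleGraph V}
    (hconn : G.Preconnected)
    (hind : ∀ x y, IsSimplicial G x → IsSimplicial G y → ¬ G.Adj x y)
    (hpath : IsPathGraph (derivedGraph G)) : IsIntervalGraph G := by
  classical
  obtain ⟨n, ⟨e⟩⟩ := hpath
  let pos : ∀ x, ¬ IsSimplicial G x → ℕ := fun x hx => (e ⟨x, hx⟩).val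
  have hpos : ∀ x y (hx : ¬ IsSimplicial G x) (hy : ¬ IsSimplicial G y),
      G.Adj x y ↔ pos x hx + 1 = pos y hy ∨ pos y hy + 1 = pos x hx := by
    intro x y hx hy
    rw [← SimpleGraph.pathGraph_adj, e.map_adj_iff]
    rfl
  have hposinj : ∀ x y (hx : ¬ IsSimplicial G x) (hy : ¬ IsSimplicial G y),
      pos x hx = pos y hy → x = y := by
    intro x y hx hy h
    exact congrArg Subtype.val (e.injective (Fin.ext h))
  -- `s x` is the sum of the least and the greatest position of a neighbor of `x`
  have hsum : ∀ x, IsSimplicial G x → ∃ s : ℕ, ∀ y (hy : ¬ IsSimplicial G y),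
      G.Adj x y ↔ s ≤ 2 * pos y hy + 1 ∧ 2 * pos y hy ≤ s + 1 := by
    intro x hx
    have h0 : ∃ y, ¬ IsSimplicial G y ∧ G.Adj x y := by
      have hz := (e.symm 0).2
      obtain ⟨x', rfl, y, -, hxy⟩ := exists_adj_mem_notMem hconn (S := {x}) rfl
        (v := (e.symm 0).1) (fun h => hz ((Set.mem_singleton_iff.1 h) ▸ hx))
      exact ⟨y, fun hy => hind _ _ hx hy hxy, hxy⟩
    obtain ⟨y, hy, hxy⟩ := h0
    by_cases h1 : ∃ z, ∃ hz : ¬ IsSimplicial G z, G.Adj x z ∧ z ≠ y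
    · obtain ⟨z, hz, hxz, hzy⟩ := h1
      -- Neighbors of `x` are pairwise adjacent, hence at consecutive positions; three are
      -- impossible.
      have hyz := (hpos _ _ hz hy).1 (hx hxz hxy hzy)
      refine ⟨pos y hy + pos z hz, fun t ht => ⟨fun h => ?_, fun h => ?_⟩⟩
      · by_cases hty : t = y
        · subst hty
          omega
        · have := (hpos _ _ ht hy).1 (hx h hxy hty)
          by_cases htz : t = z
          · subst htz
            omega
          · have := (hpos _ _ ht hz).1 (hx h hxz htz)
            omega
      · have : pos t ht = pos y hy ∨ pos t ht = pos z hz := by omega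
        rcases this with h' | h'
        · exact hposinj _ _ _ _ h' ▸ hxy
        · exact hposinj _ _ _ _ h' ▸ hxz
    · push Not at h1
      refine ⟨2 * pos y hy, fun t ht => ⟨fun h => ?_, fun h => ?_⟩⟩
      · obtain rfl := h1 t ht h
        omega
      · have : pos t ht = pos y hy := by omega
        exact hposinj _ _ _ _ this ▸ hxy
  choose s hs using hsum
  obtain ⟨k, ⟨g⟩⟩ := Finite.exists_equiv_fin V
  -- Distinct offsets in `(0, 1)` separate simplicial vertices with the same `s`.
  let ε : V → ℝ := fun x => ((g x).val + 1 : ℝ) / (k + 1)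
  have hk : (0 : ℝ) < k + 1 := by positivity
  have hε0 : ∀ x, 0 < ε x := fun x => by positivity
  have hε1 : ∀ x, ε x < 1 := fun x => by
    rw [div_lt_one hk]
    have : ((g x).val : ℝ) < k := by exact_mod_cast (g x).2
    linarith
  have hεinj : ∀ x y, ε x = ε y → x = y := by
    intro x y h
    have h1 := (div_left_inj' hk.ne').1 h
    have h2 : (g x).val = (g y).val := by exact_mod_cast add_right_cancel h1
    exact g.injective (Fin.ext h2)
  -- With intervals `[2i, 2i+3]`, the slot `(2i+1, 2i+2)` is covered by `i` alone and `(2i+2, 2i+3)`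
  -- by `i` and `i+1` alone; `s + 1 + ε` falls in the right slot.
  let a : V → ℝ := fun x =>
    if hx : IsSimplicial G x then (s x hx : ℝ) + 1 + ε x else 2 * (pos x hx : ℝ)
  let b : V → ℝ := fun x =>
    if hx : IsSimplicial G x then (s x hx : ℝ) + 1 + ε x else 2 * (pos x hx : ℝ) + 3
  have hab : ∀ x, a x ≤ b x := by
    intro x
    by_cases hx : IsSimplicial G x <;> simp [a, b, hx]
  have hmixed : ∀ x y, IsSimplicial G x → ¬ IsSimplicial G y →
      (G.Adj x y ↔ a x ≤ b y ∧ a y ≤ b x) := by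
    intro x y hx hy
    rw [hs x hx y hy]
    simp only [a, b, dif_pos hx, dif_neg hy]
    have h0 := hε0 x
    have h1 := hε1 x
    constructor
    · rintro ⟨h, h'⟩
      have h2 : (s x hx : ℝ) ≤ 2 * pos y hy + 1 := by exact_mod_cast h
      have h3 : 2 * (pos y hy : ℝ) ≤ s x hx + 1 := by exact_mod_cast h'
      constructor <;> linarith
    · rintro ⟨h, h'⟩
      have h2 : (s x hx : ℝ) < 2 * pos y hy + 2 := by linarith
      have h3 : 2 * (pos y hy : ℝ) < s x hx + 2 := by linarith
      have h2' : s x hx < 2 * pos y hy + 2 := by exact_mod_cast h2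
      have h3' : 2 * pos y hy < s x hx + 2 := by exact_mod_cast h3
      omega
  refine ⟨a, b, hab, fun x y hxy => ?_⟩
  rw [Icc_inter_Icc_nonempty_iff (hab x) (hab y)]
  by_cases hx : IsSimplicial G x
  · by_cases hy : IsSimplicial G y
    · refine iff_of_false (hind x y hx hy) ?_
      simp only [a, b, dif_pos hx, dif_pos hy]
      rintro ⟨h, h'⟩
      have h0 := hε0 x
      have h1 := hε1 x
      have h0' := hε0 y
      have h1' := hε1 y
      have h2 : (s x hx : ℝ) < s y hy + 1 := by linarith
      have h3 : (s y hy : ℝ) < s x hx + 1 := by linarith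
      have h2' : s x hx < s y hy + 1 := by exact_mod_cast h2
      have h3' : s y hy < s x hx + 1 := by exact_mod_cast h3
      have h4 : s x hx = s y hy := by omega
      rw [h4] at h h'
      exact hxy (hεinj x y (by linarith))
    · exact hmixed x y hx hy
  · by_cases hy : IsSimplicial G y
    · rw [SimpleGraph.adj_comm, hmixed y x hy hx, and_comm]
    · rw [hpos x y hx hy]
      simp only [a, b, dif_neg hx, dif_neg hy]
      have hne : pos x hx ≠ pos y hy := fun h => hxy (hposinj _ _ _ _ h)
      have h1 : 2 * (pos x hx : ℝ) ≤ 2 * pos y hy + 3 ↔ 2 * pos x hx ≤ 2 * pos y hy + 3 := by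
        exact_mod_cast Iff.rfl
      have h2 : 2 * (pos y hy : ℝ) ≤ 2 * pos x hx + 3 ↔ 2 * pos y hy ≤ 2 * pos x hx + 3 := by
        exact_mod_cast Iff.rfl
      rw [h1, h2]
      omega

end StrictlyInterval

open StrictlyInterval in
theorem theorem4p3 {V : Type*} [Finite V] (G : SimpleGraph V)
    (hnc : G ≠ ⊤) (hG : StrictlyInterval.IsStrictlyChordal G) :
    StrictlyInterval.IsStrictlyIntervalGraph G ↔
      StrictlyInterval.IsPathGraph
        (StrictlyInterval.derivedGraph (StrictlyInterval.criticalCliqueGraph G)) := by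
  have := hG.nonempty
  have hp := isTwinBlowup_toCriticalClique G
  have hconn := hG.connected_criticalCliqueGraph.preconnected
  have hind : ∀ Q R, IsSimplicial (criticalCliqueGraph G) Q →
      IsSimplicial (criticalCliqueGraph G) R → ¬ (criticalCliqueGraph G).Adj Q R :=
    fun Q R hQ hR h =>
      h.ne (not_trueTwins_criticalCliqueGraph G (trueTwins_of_adj_of_isSimplicial h hQ hR))
  rw [IsStrictlyIntervalGraph, and_iff_right hG, hp.isIntervalGraph_iff]
  refine ⟨fun hint => ?_, isIntervalGraph_of_isPathGraph_derivedGraph hconn hind⟩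
  refine isPathGraph_derivedGraph hconn hG.diamondFree_criticalCliqueGraph hint ?_
  -- If all critical cliques were simplicial, independence and connectedness would leave only one,
  -- making `G` complete.
  by_contra! hall
  refine hnc (SimpleGraph.ext (funext fun x => funext fun y => propext ?_))
  rw [hp.2, SimpleGraph.top_adj, and_iff_left_iff_imp]
  refine fun _ => Or.inl (by_contra fun hne => ?_)
  obtain ⟨Q, -, R, -, hQR⟩ := exists_adj_mem_notMem hconn (S := {toCriticalClique G x}) rfl
    (v := toCriticalClique G y) (Ne.symm hne)
  exact hind Q R (hall Q) (hall R) hQR
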